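/- All graphs are simple, undirected and possibly infinite. A *tree-decomposition* of a graph $G$ is a pair $(T,(V_t)_{t\in V(T)})$ of a (possibly infinite) tree $T$ and sets $V_t\subseteq V(G)$ (its *bags*) such that $\bigcup_{t\in V(T)} G[V_t]=G$ and, for every vertex $v$ of $G$, the graph $T[\{t: v\in V_t\}]$ is connected. For $k \in \mathbb{N}=\{0,1,2,\dots\}$, it has *width* $<k$ if $|V_t|\le k$ for every node $t$ of $T$, and $G$ has *tree-width* $<k$ if it has a tree-decomposition of width $<k$. A *bramble* in $G$ is a set $\mathcal B$ of non-empty sets $U\subseteq V(G)$ with $G[U]$ connected, any two of which touch, that is, have a vertex in common or are joined by an edge of $G$. The *order* of $\mathcal B$ is the least number of vertices in a set $X\subseteq V(G)$ that meets every element of $\mathcal B$. The bramble $\mathcal B$ is *finite* if all its elements are finite sets ($\mathcal B$ itself may be infinite). **Theorem 6.2.** Let $k\in\mathbb N$. A graph has tree-width $<k$ if and only if it contains no finite bramble of order $>k$. -/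

import Mathlib

universe u

namespace SimpleGraph

/-- A tree-decomposition of a graph `G`: a (possibly infinite) tree together with a family of
vertex sets of `G` indexed by its nodes, the bags, such that the induced subgraphs on the bags
together cover all vertices and all edges of `G`, and such that for every vertex `v` of `G` the
nodes whose bags contain `v` induce a connected subgraph of the tree. -/
structure TreeDecomposition {V : Type u} (G : SimpleGraph V) where
  /-- The nodes of the decomposition tree. -/
  Node : Type u
  /-- The decomposition tree. -/
  tree : SimpleGraph Node
  isTree : tree.IsTree
  /-- The bag of a node. -/
  bag : Node → Set V
  exists_mem_bag : ∀ v : V, ∃ t, v ∈ bag t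
  exists_adj_mem_bag : ∀ v w : V, G.Adj v w → ∃ t, v ∈ bag t ∧ w ∈ bag t
  connected_of_vertex : ∀ v : V, (tree.induce {t | v ∈ bag t}).Connected

/-- The tree-decomposition has width `< k`: every bag has at most `k` vertices (the width being
one less than the largest size of a bag). -/
def TreeDecomposition.WidthLT {V : Type u} {G : SimpleGraph V} (D : G.TreeDecomposition)
    (k : ℕ) : Prop :=
  ∀ t : D.Node, (D.bag t).encard ≤ k

/-- `G` has tree-width `< k`: it admits a tree-decomposition of width `< k`. -/
def TreewidthLT {V : Type u} (G : SimpleGraph V) (k : ℕ) : Prop :=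
  ∃ D : G.TreeDecomposition, D.WidthLT k

/-- Two sets of vertices touch if they have a common vertex or there is an edge between them. -/
def Touch {V : Type u} (G : SimpleGraph V) (A B : Set V) : Prop :=
  (A ∩ B).Nonempty ∨ ∃ a ∈ A, ∃ b ∈ B, G.Adj a b

/-- A bramble in `G`: a set of mutually touching (non-empty) connected sets of vertices. -/
structure IsBramble {V : Type u} (G : SimpleGraph V) (𝓑 : Set (Set V)) : Prop where
  connected : ∀ A ∈ 𝓑, (G.induce A).Connected
  touch : ∀ A ∈ 𝓑, ∀ B ∈ 𝓑, G.Touch A B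

/-- A bramble is finite if all its elements are finite sets; it may have infinitely many
elements. -/
structure IsFiniteBramble {V : Type u} (G : SimpleGraph V) (𝓑 : Set (Set V)) : Prop
    extends G.IsBramble 𝓑 where
  finite : ∀ A ∈ 𝓑, A.Finite

/-- A set of vertices covers a family of vertex sets if it meets all of them. -/
def Covers {V : Type u} (X : Set V) (𝓑 : Set (Set V)) : Prop :=
  ∀ A ∈ 𝓑, (X ∩ A).Nonempty

/-- The order of a bramble: the least number of vertices of a set covering it, which is `⊤` if
there is no finite such set. -/
noncomputable def brambleOrder {V : Type u} (𝓑 : Set (Set V)) : ℕ∞ :=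
  ⨅ X ∈ {X : Set V | Covers X 𝓑}, X.encard

end SimpleGraph

/-! The link between the two sides is a chordal supergraph `H` of `G` whose cliques have at most `k`
vertices. Chordality is expressed by `Elim`, which speaks of finite vertex sets only and therefore
survives limits.

If no finite bramble has order `> k`, then, as brambles of finite induced subgraphs are finite
brambles of `G`, the finite duality `exists_elim_of_forall_isBramble` yields such a supergraph for
every finite induced subgraph. An ultrafilter limit, `exists_elim_of_finset`, combines these into
one for `G`. Because its cliques are bounded, `Elim.exists_rank` well-orders the vertices so that
the earlier neighbours of each form a clique, and `treewidthLT_of_rank` arranges the resulting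
cliques in a tree.

The finite duality is strengthened to brambles `𝓑`: there is a chordal supergraph in which every
clique with more than `k` vertices misses an element of `𝓑`; the case `𝓑 = ∅` is the goal. For a
minimum cover `X`, the components `C` of `G - X` are treated separately and glued along `X`. If `C`
touches all of `𝓑`, a graph for the larger bramble `𝓑 ∪ {C}` is reshaped to contain `X` as a clique,
and the minimality of `X` controls the cliques.

Conversely, the Helly property of subtrees puts a cover of any finite part of a bramble into one
bag; as the elements are finite sets, `exists_cover_of_finite_subfamilies` then gives a cover of the
whole bramble. -/

namespace SimpleGraph

/-! ### Connected sets, described by cuts -/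

/-- A set of vertices is connected if it is non-empty and every bipartition of it into two
non-empty sets is crossed by an edge. -/
def ConnOn {V : Type u} (G : SimpleGraph V) (A : Set V) : Prop :=
  A.Nonempty ∧ ∀ Q : Set V, (A ∩ Q).Nonempty → (A \ Q).Nonempty →
    ∃ a ∈ A, a ∈ Q ∧ ∃ b ∈ A, b ∉ Q ∧ G.Adj a b

theorem connOn_iff_induce_connected {V : Type u} {G : SimpleGraph V} {A : Set V} :
    G.ConnOn A ↔ (G.induce A).Connected := by
  constructor
  · rintro ⟨⟨a, ha⟩, h⟩
    have hr : ∀ x : A, (G.induce A).Reachable ⟨a, ha⟩ x := by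
      by_contra! hx
      obtain ⟨⟨x, hxA⟩, hx⟩ := hx
      obtain ⟨b, hb, ⟨hb', hr⟩, c, hc, hc', hbc⟩ := h
        {y | ∃ hy : y ∈ A, (G.induce A).Reachable ⟨a, ha⟩ ⟨y, hy⟩}
        ⟨a, ha, ha, Reachable.refl _⟩ ⟨x, hxA, fun ⟨_, h⟩ => hx h⟩
      refine hc' ⟨hc, hr.trans (Adj.reachable ?_)⟩
      simpa using hbc
    have : Nonempty A := ⟨⟨a, ha⟩⟩
    exact ⟨fun x y => (hr x).symm.trans (hr y)⟩
  · intro h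
    obtain ⟨⟨a, ha⟩⟩ := h.nonempty
    refine ⟨⟨a, ha⟩, ?_⟩
    rintro Q ⟨x, hx, hxQ⟩ ⟨y, hy, hyQ⟩
    obtain ⟨p⟩ := h.preconnected ⟨x, hx⟩ ⟨y, hy⟩
    obtain ⟨d, -, h1, h2⟩ := p.exists_boundary_dart {z | (z : V) ∈ Q} hxQ hyQ
    exact ⟨d.fst, d.fst.2, h1, d.snd, d.snd.2, h2, by simpa using d.adj⟩

theorem connOn_singleton {V : Type u} (G : SimpleGraph V) (v : V) : G.ConnOn {v} := by
  refine ⟨⟨v, rfl⟩, ?_⟩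
  rintro Q ⟨x, rfl, hx⟩ ⟨y, rfl, hy⟩
  exact absurd hx hy

/-- A union of connected sets with a common vertex is connected. -/
theorem connOn_sUnion {V : Type u} {G : SimpleGraph V} {𝒜 : Set (Set V)} {v : V}
    (hne : 𝒜.Nonempty) (hv : ∀ A ∈ 𝒜, v ∈ A) (h : ∀ A ∈ 𝒜, G.ConnOn A) :
    G.ConnOn (⋃₀ 𝒜) := by
  obtain ⟨A₀, hA₀⟩ := hne
  refine ⟨⟨v, A₀, hA₀, hv _ hA₀⟩, ?_⟩
  rintro Q ⟨x, ⟨A, hA, hxA⟩, hxQ⟩ ⟨y, ⟨B, hB, hyB⟩, hyQ⟩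
  by_cases hvQ : v ∈ Q
  · obtain ⟨a, ha, haQ, b, hb, hbQ, hab⟩ := (h B hB).2 Q ⟨v, hv B hB, hvQ⟩ ⟨y, hyB, hyQ⟩
    exact ⟨a, ⟨B, hB, ha⟩, haQ, b, ⟨B, hB, hb⟩, hbQ, hab⟩
  · obtain ⟨a, ha, haQ, b, hb, hbQ, hab⟩ := (h A hA).2 Q ⟨x, hxA, hxQ⟩ ⟨v, hv A hA, hvQ⟩
    exact ⟨a, ⟨A, hA, ha⟩, haQ, b, ⟨A, hA, hb⟩, hbQ, hab⟩

theorem ConnOn.union {V : Type u} {G : SimpleGraph V} {A B : Set V} {v : V}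
    (hA : G.ConnOn A) (hB : G.ConnOn B) (hvA : v ∈ A) (hvB : v ∈ B) : G.ConnOn (A ∪ B) := by
  rw [← Set.sUnion_pair]
  exact connOn_sUnion (v := v) ⟨A, by simp⟩ (by simp [hvA, hvB]) (by simp [hA, hB])

theorem ConnOn.insert {V : Type u} {G : SimpleGraph V} {A : Set V} {v a : V}
    (hA : G.ConnOn A) (ha : a ∈ A) (hva : G.Adj v a) : G.ConnOn (insert v A) := by
  have h2 : G.ConnOn {v, a} := by
    refine ⟨⟨v, by simp⟩, ?_⟩
    rintro Q ⟨x, hx, hxQ⟩ ⟨y, hy, hyQ⟩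
    refine ⟨x, hx, hxQ, y, hy, hyQ, ?_⟩
    have := hva.symm
    rcases hx with rfl | rfl <;> rcases hy with rfl | rfl <;> first | assumption | contradiction
  have := h2.union hA (v := a) (by simp) ha
  have e : ({v, a} : Set V) ∪ A = Insert.insert v A := by
    ext x; simp only [Set.mem_union, Set.mem_insert_iff, Set.mem_singleton_iff]
    constructor
    · rintro ((h | rfl) | h) <;> simp_all
    · rintro (h | h) <;> simp_all
  rwa [e] at this

/-! ### Simplicial vertices and chordal graphs -/

/-- The vertex `v` is simplicial in `F`: its neighbours in `F` are pairwise adjacent. -/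
def SimplicialIn {V : Type u} (H : SimpleGraph V) (F : Set V) (v : V) : Prop :=
  ∀ a ∈ F, ∀ b ∈ F, H.Adj v a → H.Adj v b → a ≠ b → H.Adj a b

/-- Every non-empty finite set of vertices has a simplicial vertex. For finite graphs this is
equivalent to being chordal. -/
def Elim {V : Type u} (H : SimpleGraph V) : Prop :=
  ∀ F : Finset V, F.Nonempty → ∃ v ∈ F, H.SimplicialIn F v

/-- A passage through `s` can be short-cut, since its neighbours are adjacent. The cut is tested
with `s` on either side; if both crossing edges use `s`, their other ends are adjacent and cross the
cut. -/
theorem ConnOn.diff_simplicial {V : Type u} {H : SimpleGraph V} {A : Set V} {s : V}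
    (hA : H.ConnOn A) (hs : H.SimplicialIn A s) (hne : (A \ {s}).Nonempty) :
    H.ConnOn (A \ {s}) := by
  refine ⟨hne, ?_⟩
  rintro Q ⟨x, ⟨hx, hxs⟩, hxQ⟩ ⟨y, ⟨hy, hys⟩, hyQ⟩
  simp only [Set.mem_singleton_iff] at hxs hys
  obtain ⟨a, ha, haQ, b, hb, hbQ, hab⟩ := hA.2 (Q ∪ {s}) ⟨x, hx, .inl hxQ⟩
    ⟨y, hy, by simp [hyQ, hys]⟩
  obtain ⟨a', ha', haQ', b', hb', hbQ', hab'⟩ := hA.2 (Q \ {s}) ⟨x, hx, hxQ, hxs⟩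
    ⟨y, hy, by simp [hyQ]⟩
  simp only [Set.mem_union, Set.mem_singleton_iff, not_or, Set.mem_sdiff, not_and,
    not_not] at haQ hbQ haQ' hbQ'
  by_cases has : a = s
  · by_cases hbs : b' = s
    · subst has; subst hbs
      refine ⟨a', ⟨ha', haQ'.2⟩, haQ'.1, b, ⟨hb, hbQ.2⟩, hbQ.1, ?_⟩
      refine hs a' ha' b hb hab'.symm hab ?_
      rintro rfl
      exact hbQ.1 haQ'.1
    · exact ⟨a', ⟨ha', haQ'.2⟩, haQ'.1, b', ⟨hb', hbs⟩, fun h => hbs (hbQ' h), hab'⟩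
  · exact ⟨a, ⟨ha, has⟩, haQ.resolve_right has, b, ⟨hb, hbQ.2⟩, hbQ.1, hab⟩

theorem SimplicialIn.mono {V : Type u} {H : SimpleGraph V} {F F' : Set V} {v : V}
    (h : H.SimplicialIn F v) (hF : F' ⊆ F) : H.SimplicialIn F' v :=
  fun a ha b hb => h a (hF ha) b (hF hb)

/-- In a chordal graph, if every vertex of a finite clique has a neighbour in a finite connected
set disjoint from the clique, then some vertex of that set is adjacent to the whole clique. -/
theorem Elim.exists_adj_clique {V : Type u} {H : SimpleGraph V} (hH : H.Elim) (K : Finset V)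
    (hK : H.IsClique K) : ∀ (n : ℕ) (A : Finset V), A.card = n → H.ConnOn A → Disjoint K A →
    (∀ x ∈ K, ∃ a ∈ A, H.Adj x a) → ∃ a ∈ A, ∀ x ∈ K, H.Adj x a := by
  classical
  intro n
  induction n with
  | zero =>
    intro A hA hc
    rw [Finset.card_eq_zero] at hA
    subst hA
    simpa using hc.1
  | succ n ih =>
    intro A hA hc hd hx
    obtain ⟨a₀, ha₀⟩ := hc.1
    -- If `s ∈ A`, it can be deleted: a vertex of `K` attached at `s` is also adjacent to any
    -- further neighbour `t` of `s` in `A`. If `s ∈ K`, any neighbour of `s` in `A` is adjacent to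
    -- all of `K`.
    obtain ⟨s, hs, hsim⟩ := hH (A ∪ K) ⟨a₀, by simp at ha₀; simp [ha₀]⟩
    rw [Finset.mem_union] at hs
    rcases hs with hs | hs
    · by_cases hne : (A.erase s).Nonempty
      · have hc' : H.ConnOn (A.erase s) := by
          rw [Finset.coe_erase]
          refine hc.diff_simplicial (hsim.mono (by simp)) ?_
          rw [← Finset.coe_erase]; exact_mod_cast hne
        obtain ⟨t, htA, hst⟩ : ∃ t ∈ A.erase s, H.Adj s t := by
          obtain ⟨t₀, ht₀⟩ := hne
          obtain ⟨a, ha, haQ, b, hb, hbQ, hab⟩ := hc.2 {s} ⟨s, by simpa using hs, rfl⟩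
            ⟨t₀, by simpa [and_comm] using ht₀⟩
          rw [Set.mem_singleton_iff] at haQ hbQ
          subst haQ
          exact ⟨b, by simpa [hbQ] using hb, hab⟩
        have hx' : ∀ x ∈ K, ∃ a ∈ A.erase s, H.Adj x a := by
          intro x hxK
          obtain ⟨a, ha, hxa⟩ := hx x hxK
          by_cases has : a = s
          · subst has
            refine ⟨t, htA, hsim x (by simp [hxK]) t (by simp [Finset.mem_of_mem_erase htA])
              hxa.symm hst ?_⟩
            rintro rfl
            exact Finset.disjoint_left.1 hd hxK (Finset.mem_of_mem_erase htA)
          · exact ⟨a, Finset.mem_erase.2 ⟨has, ha⟩, hxa⟩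
        obtain ⟨a, ha, hK⟩ := ih (A.erase s) (by rw [Finset.card_erase_of_mem hs, hA]; rfl) hc'
          (hd.mono_right (Finset.erase_subset _ _)) hx'
        exact ⟨a, Finset.mem_of_mem_erase ha, hK⟩
      · refine ⟨s, hs, fun x hxK => ?_⟩
        obtain ⟨a, ha, hxa⟩ := hx x hxK
        have : a = s := by
          by_contra h
          exact hne ⟨a, Finset.mem_erase.2 ⟨h, ha⟩⟩
        rwa [← this]
    · obtain ⟨a, ha, hsa⟩ := hx s hs
      refine ⟨a, ha, fun x hxK => ?_⟩
      by_cases hxs : x = s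
      · rwa [hxs]
      · refine hsim x (by simp [hxK]) a (by simp [ha]) (hK hs hxK (Ne.symm hxs)) hsa ?_
        rintro rfl
        exact Finset.disjoint_left.1 hd hxK ha

/-! ### Well-ordering the vertices of a chordal graph -/

/-- Vertices in `S` attaching to a common connected set outside `S` are adjacent. -/
def CliqueAttached {V : Type u} (H : SimpleGraph V) (S : Set V) : Prop :=
  ∀ A : Set V, A.Finite → H.ConnOn A → Disjoint A S → ∀ x ∈ S, ∀ y ∈ S, x ≠ y →
    (∃ a ∈ A, H.Adj x a) → (∃ a ∈ A, H.Adj y a) → H.Adj x y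

/-- The vertex `v` lies outside `S` and is adjacent to all vertices of `S` which attach to the
component of the complement of `S` containing `v`. -/
def DominatesAttachment {V : Type u} (H : SimpleGraph V) (S : Set V) (v : V) : Prop :=
  v ∉ S ∧ ∀ A : Set V, A.Finite → H.ConnOn A → Disjoint A S → v ∈ A → ∀ x ∈ S,
    (∃ a ∈ A, H.Adj x a) → H.Adj x v

theorem finite_of_isClique {V : Type u} {H : SimpleGraph V} {n : ℕ}
    (hn : ∀ K : Finset V, H.IsClique K → K.card ≤ n) {N : Set V} (hN : H.IsClique N) :
    N.Finite := by
  by_contra h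
  obtain ⟨t, ht, hc⟩ := Set.Infinite.exists_subset_card_eq h (n + 1)
  have := hn t (hN.subset ht)
  omega

/-- The vertices `N` of `S` attached to the component of some `v₀ ∉ S` form a clique, which is
finite by the clique bound. Hence one finite connected set `A₀` already attaches to all of `N`, and
`Elim.exists_adj_clique` applies to it. -/
theorem CliqueAttached.exists_dominatesAttachment {V : Type u} {H : SimpleGraph V}
    (hH : H.Elim) {n : ℕ} (hn : ∀ K : Finset V, H.IsClique K → K.card ≤ n) {S : Set V}
    (hS : H.CliqueAttached S) (hne : S ≠ Set.univ) : ∃ v, H.DominatesAttachment S v := by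
  classical
  obtain ⟨v₀, hv₀⟩ := (Set.ne_univ_iff_exists_notMem S).1 hne
  set N : Set V := {x | x ∈ S ∧ ∃ A : Set V, A.Finite ∧ H.ConnOn A ∧ Disjoint A S ∧ v₀ ∈ A ∧
    ∃ a ∈ A, H.Adj x a} with hN
  have hNc : H.IsClique N := by
    rintro x ⟨hx, A, hAf, hA, hAS, hvA, a, ha, hxa⟩ y ⟨hy, B, hBf, hB, hBS, hvB, b, hb, hyb⟩ hxy
    exact hS (A ∪ B) (hAf.union hBf) (hA.union hB hvA hvB) (hAS.union_left hBS) x hx y hy hxy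
      ⟨a, .inl ha, hxa⟩ ⟨b, .inr hb, hyb⟩
  have hNf := finite_of_isClique hn hNc
  choose hxS A hAf hA hAS hvA hxA using fun x : N => x.2
  set A₀ : Set V := ⋃₀ (insert {v₀} (Set.range A)) with hA₀
  have : Finite N := hNf
  have hA₀f : A₀.Finite := by
    refine Set.Finite.sUnion ((Set.finite_range A).insert _) ?_
    rintro t (rfl | ⟨x, rfl⟩)
    · exact Set.finite_singleton _
    · exact hAf x
  have hA₀c : H.ConnOn A₀ := by
    refine connOn_sUnion (v := v₀) ⟨_, Set.mem_insert _ _⟩ ?_ ?_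
    · rintro t (rfl | ⟨x, rfl⟩)
      · rfl
      · exact hvA x
    · rintro t (rfl | ⟨x, rfl⟩)
      · exact connOn_singleton _ _
      · exact hA x
  have hA₀S : Disjoint A₀ S := by
    rw [Set.disjoint_sUnion_left]
    rintro t (rfl | ⟨x, rfl⟩)
    · simpa using hv₀
    · exact hAS x
  have hv₀A : v₀ ∈ A₀ := ⟨_, Set.mem_insert _ _, rfl⟩
  obtain ⟨a, ha, hadj⟩ := hH.exists_adj_clique hNf.toFinset (by simpa using hNc) _ hA₀f.toFinset
    rfl (by simpa using hA₀c) (by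
      rw [Finset.disjoint_left]
      intro x hx hx'
      simp only [Set.Finite.mem_toFinset] at hx hx'
      exact Set.disjoint_left.1 hA₀S hx' hx.1) (by
      intro x hx
      simp only [Set.Finite.mem_toFinset] at hx
      obtain ⟨a, ha, hxa⟩ := hxA ⟨x, hx⟩
      exact ⟨a, by simpa using ⟨_, Set.mem_insert_of_mem _ ⟨⟨x, hx⟩, rfl⟩, ha⟩, hxa⟩)
  simp only [Set.Finite.mem_toFinset] at ha hadj
  refine ⟨a, Set.disjoint_left.1 hA₀S ha, fun B hBf hB hBS haB x hx ⟨b, hb, hxb⟩ => ?_⟩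
  exact hadj x ⟨hx, B ∪ A₀, hBf.union hA₀f, hB.union hA₀c haB ha, hBS.union_left hA₀S,
    .inr hv₀A, b, .inl hb, hxb⟩

/-- A family of vertices indexed by an initial segment of the ordinals, each of which dominates the
attachment of its component to the earlier ones, has clique-attached range. -/
theorem cliqueAttached_of_dominates {V : Type u} {H : SimpleGraph V} (f : Ordinal.{u} → V)
    (α : Ordinal.{u}) (hf : ∀ β < α, H.DominatesAttachment (f '' Set.Iio β) (f β)) :
    H.CliqueAttached (f '' Set.Iio α) := by
  have key : ∀ A : Set V, A.Finite → H.ConnOn A → Disjoint A (f '' Set.Iio α) →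
      ∀ β < α, ∀ γ < β, (∃ a ∈ A, H.Adj (f γ) a) → (∃ a ∈ A, H.Adj (f β) a) →
      H.Adj (f γ) (f β) := by
    rintro A hAf hA hAS β hβ γ hγ ⟨a, ha, hxa⟩ ⟨b, hb, hyb⟩
    -- Adding the later vertex `f β` to `A` keeps it connected and disjoint from everything before
    -- `β`, so `f β` dominates its attachments.
    refine (hf β hβ).2 (insert (f β) A) (hAf.insert _) (hA.insert hb hyb) ?_
      (Set.mem_insert _ _) _ ⟨γ, hγ, rfl⟩ ⟨a, .inr ha, hxa⟩
    rw [Set.disjoint_insert_left]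
    exact ⟨(hf β hβ).1, hAS.mono_right (Set.image_mono (Set.Iio_subset_Iio hβ.le))⟩
  rintro A hAf hA hAS _ ⟨β, hβ, rfl⟩ _ ⟨γ, hγ, rfl⟩ hne h1 h2
  rcases lt_trichotomy β γ with h | rfl | h
  · exact key A hAf hA hAS γ hγ β h h1 h2
  · exact absurd rfl hne
  · exact (key A hAf hA hAS β hβ γ h h2 h1).symm

/-- A chordal graph with bounded clique size has a well-ordering of its vertices, starting with any
prescribed clique, in which the earlier neighbours of every vertex form a clique. -/
theorem Elim.exists_rank {V : Type u} {H : SimpleGraph V}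
    (hH : H.Elim) {n : ℕ} (hn : ∀ K : Finset V, H.IsClique K → K.card ≤ n) {K : Set V}
    (hK : H.IsClique K) : ∃ ρ : V → Ordinal.{u}, Function.Injective ρ ∧
      (∀ v a b, H.Adj v a → H.Adj v b → ρ a < ρ v → ρ b < ρ v → a ≠ b → H.Adj a b) ∧
      ∀ a ∈ K, ∀ b ∉ K, ρ a < ρ b := by
  classical
  rcases isEmpty_or_nonempty V with hV | hV
  · exact ⟨fun _ => 0, fun a => isEmptyElim a, fun a => isEmptyElim a, fun a => isEmptyElim a⟩
  -- The second clause forces the recursion to use up `K` first.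
  let good (S : Set V) (v : V) : Prop := H.DominatesAttachment S v ∧ (K ⊆ S ∨ v ∈ K)
  let pick (S : Set V) : V := Classical.epsilon (good S)
  have hpick : ∀ S : Set V, S ≠ Set.univ → H.CliqueAttached S → (K ⊆ S ∨ S ⊆ K) →
      good S (pick S) := by
    intro S hS hc hKS
    refine Classical.epsilon_spec (p := good S) ?_
    by_cases h : K ⊆ S
    · obtain ⟨v, hv⟩ := hc.exists_dominatesAttachment hH hn hS
      exact ⟨v, hv, .inl h⟩
    -- While `K` is not used up, `S ⊆ K`, and any further vertex of the clique `K` is adjacent to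
    -- all of `S`.
    · obtain ⟨v, hvK, hvS⟩ := Set.not_subset.1 h
      refine ⟨v, ⟨hvS, fun A _ _ _ _ x hx _ => ?_⟩, .inr hvK⟩
      refine hK (hKS.resolve_left h hx) hvK ?_
      rintro rfl
      exact hvS hx
  let f : Ordinal.{u} → V := WellFounded.fix (Ordinal.lt_wf) fun α F =>
    pick {v | ∃ β, ∃ h : β < α, F β h = v}
  have hf : ∀ α, f α = pick (f '' Set.Iio α) := by
    intro α
    have : f α = pick {v | ∃ β, ∃ h : β < α, f β = v} := WellFounded.fix_eq _ _ _
    rw [this]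
    congr 1
    ext v
    simp
  have hgood : ∀ α, (∀ β ≤ α, f '' Set.Iio β ≠ Set.univ) → good (f '' Set.Iio α) (f α) := by
    intro α
    induction α using WellFoundedLT.induction with
    | _ α ih =>
      intro hα
      have ih' : ∀ β < α, good (f '' Set.Iio β) (f β) :=
        fun β hβ => ih β hβ fun γ hγ => hα γ (hγ.trans hβ.le)
      rw [hf α]
      refine hpick _ (hα α le_rfl) (cliqueAttached_of_dominates f α fun β hβ => (ih' β hβ).1) ?_
      by_cases h : ∃ β < α, K ⊆ f '' Set.Iio β
      · obtain ⟨β, hβ, h⟩ := h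
        exact .inl (h.trans (Set.image_mono (Set.Iio_subset_Iio hβ.le)))
      · push Not at h
        right
        rintro _ ⟨β, hβ, rfl⟩
        exact (ih' β hβ).2.resolve_left (h β hβ)
  obtain ⟨α, hα, hmin⟩ : ∃ α, f '' Set.Iio α = Set.univ ∧
      ∀ β < α, f '' Set.Iio β ≠ Set.univ := by
    have hex : ∃ α, f '' Set.Iio α = Set.univ := by
      by_contra! h
      -- If `V` were never exhausted, `f` would inject all ordinals into `V`.
      refine not_injective_of_ordinal f ?_
      have hlt : ∀ α β, α < β → f α ≠ f β := fun α β hαβ he =>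
        (hgood β fun γ _ => h γ).1.1 ⟨α, hαβ, he⟩
      intro α β he
      rcases lt_trichotomy α β with h' | h' | h'
      · exact absurd he (hlt _ _ h')
      · exact h'
      · exact absurd he.symm (hlt _ _ h')
    have := WellFounded.has_min Ordinal.lt_wf {α : Ordinal.{u} | f '' Set.Iio α = Set.univ} hex
    obtain ⟨α, h1, h2⟩ := this
    exact ⟨α, h1, fun β hβ h => h2 β h hβ⟩
  have hg : ∀ β < α, good (f '' Set.Iio β) (f β) := fun β hβ =>
    hgood β fun γ hγ => hmin γ (hγ.trans_lt hβ)
  have hsurj : ∀ v, ∃ β < α, f β = v := fun v => by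
    have : v ∈ f '' Set.Iio α := hα ▸ Set.mem_univ v
    exact this
  choose ρ hρ hfρ using hsurj
  have hmem : ∀ a v, ρ a < ρ v → a ∈ f '' Set.Iio (ρ v) := fun a v h => ⟨ρ a, h, hfρ a⟩
  refine ⟨ρ, fun a b h => by rw [← hfρ a, ← hfρ b, h], ?_, ?_⟩
  · intro v a b hva hvb ha hb hab
    have hc := cliqueAttached_of_dominates f (ρ v) fun β hβ => (hg β (hβ.trans (hρ v))).1
    have hv : v ∉ f '' Set.Iio (ρ v) := by
      have := (hg (ρ v) (hρ v)).1.1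
      rwa [hfρ v] at this
    exact hc {v} (Set.finite_singleton v) (connOn_singleton H v) (by simpa using hv) a (hmem a v ha) b
      (hmem b v hb) hab ⟨v, rfl, hva.symm⟩ ⟨v, rfl, hvb.symm⟩
  · intro a ha b hb
    have h := (hg (ρ b) (hρ b)).2
    rw [hfρ b] at h
    obtain ⟨γ, hγ, hγa⟩ := h.resolve_right hb ha
    by_contra! hle
    have hγ' : γ < ρ a := lt_of_lt_of_le hγ hle
    have := (hg (ρ a) (hρ a)).1.1
    rw [hfρ a] at this
    exact this ⟨γ, hγ', hγa⟩

/-! ### From an ordering to a tree-decomposition -/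

/-- The graph in which every node other than the root is joined to its parent. -/
def parentGraph {T : Type u} (r : T) (par : T → T) : SimpleGraph T :=
  fromRel fun t s => t ≠ r ∧ par t = s

theorem parentGraph_adj {T : Type u} {r : T} {par : T → T} {t s : T} :
    (parentGraph r par).Adj t s ↔ t ≠ s ∧ ((t ≠ r ∧ par t = s) ∨ (s ≠ r ∧ par s = t)) :=
  fromRel_adj _ _ _

/-- Ranks drop along parents, so every node reaches the root. Every edge is a bridge: the only edge
leaving the set of descendants of `t` is the one from `t` to its parent. -/
theorem parentGraph_isTree {T : Type u} (r : T) (par : T → T) {O : Type*} [LinearOrder O]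
    [WellFoundedLT O] (rank : T → O) (h : ∀ t, t ≠ r → rank (par t) < rank t) :
    (parentGraph r par).IsTree := by
  have hadj : ∀ t, t ≠ r → (parentGraph r par).Adj t (par t) := by
    intro t ht
    rw [parentGraph_adj]
    refine ⟨fun e => ?_, .inl ⟨ht, rfl⟩⟩
    have := h t ht
    rw [← e] at this
    exact lt_irrefl _ this
  have hreach : ∀ o t, rank t = o → (parentGraph r par).Reachable t r := by
    intro o
    induction o using WellFoundedLT.induction with
    | _ o ih =>
      rintro t rfl
      by_cases ht : t = r
      · rw [ht]
      · exact (hadj t ht).reachable.trans (ih _ (h t ht) _ rfl)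
  have : Nonempty T := ⟨r⟩
  refine ⟨⟨fun s t => (hreach _ s rfl).trans (hreach _ t rfl).symm⟩, ?_⟩
  rw [isAcyclic_iff_forall_adj_isBridge]
  have key : ∀ t, t ≠ r →
      ¬ (parentGraph r par \ fromEdgeSet {s(t, par t)}).Reachable t (par t) := by
    rintro t ht ⟨p⟩
    let step : T → T → Prop := fun y z => y ≠ r ∧ par y = z
    have hmono : ∀ y z, Relation.ReflTransGen step y z → rank z ≤ rank y := by
      intro y z hyz
      induction hyz with
      | refl => exact le_rfl
      | tail _ hs ih => exact (hs.2 ▸ h _ hs.1).le.trans ih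
    obtain ⟨d, -, hd1, hd2⟩ := p.exists_boundary_dart {y | Relation.ReflTransGen step y t}
      Relation.ReflTransGen.refl fun hp => (h t ht).not_ge (hmono _ _ hp)
    obtain ⟨hd, hne⟩ := (sdiff_adj _ _ _ _).1 d.adj
    rw [parentGraph_adj] at hd
    rcases hd.2 with hs | hs
    · rcases Relation.ReflTransGen.cases_head hd1 with he | ⟨c, hc, hct⟩
      · refine hne ?_
        rw [fromEdgeSet_adj]
        refine ⟨?_, hd.1⟩
        rw [← hs.2, he]
        rfl
      · exact hd2 (hs.2 ▸ hc.2 ▸ hct)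
    · exact hd2 (Relation.ReflTransGen.head hs hd1)
  intro v w hvw
  rw [isBridge_iff]
  have hvw' := hvw
  rw [parentGraph_adj] at hvw'
  rcases hvw'.2 with ⟨hv, rfl⟩ | ⟨hw, rfl⟩
  · exact key v hv
  · rw [Sym2.eq_swap]
    exact fun hr => key w hw hr.symm

/-- A well-founded injective ranking of the vertices of a supergraph in which earlier neighbours
form cliques yields a tree-decomposition into cliques of the supergraph. -/
theorem treewidthLT_of_rank {V : Type u} {G H : SimpleGraph V} (hGH : G ≤ H) {k : ℕ}
    (hk : ∀ K : Finset V, H.IsClique K → K.card ≤ k) {O : Type*} [LinearOrder O]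
    [WellFoundedLT O] (ρ : V → O) (hρ : Function.Injective ρ)
    (hc : ∀ v a b, H.Adj v a → H.Adj v b → ρ a < ρ v → ρ b < ρ v → a ≠ b → H.Adj a b) :
    G.TreewidthLT k := by
  classical
  let E (v : V) : Set V := {a | H.Adj v a ∧ ρ a < ρ v}
  have hEc : ∀ v, H.IsClique (insert v (E v)) := by
    intro v
    rw [isClique_insert]
    exact ⟨fun a ha b hb hab => hc v a b ha.1 hb.1 ha.2 hb.2 hab, fun b hb _ => hb.1⟩
  have hEf : ∀ v, (insert v (E v)).Finite := fun v => finite_of_isClique hk (hEc v)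
  have hmax : ∀ v, (E v).Nonempty → ∃ p ∈ E v, ∀ a ∈ E v, ρ a ≤ ρ p := fun v hv =>
    Set.exists_max_image (E v) ρ ((hEf v).subset (Set.subset_insert _ _)) hv
  -- The parent of `v` is its latest earlier neighbour `p`; the other earlier neighbours of `v` are
  -- adjacent to `p` and precede it, so they lie in the bag of `p`. The extra root `none`, with
  -- empty bag, is the parent of the vertices without earlier neighbours.
  let par : Option V → Option V := fun t => t.elim none fun v =>
    if h : (E v).Nonempty then some (hmax v h).choose else none
  let bag : Option V → Set V := fun t => t.elim ∅ fun v => insert v (E v)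
  let rank : Option V → WithBot O := fun t => t.elim ⊥ fun v => (ρ v : WithBot O)
  have hpar : ∀ v, (E v).Nonempty → ∃ p, par (some v) = some p ∧ p ∈ E v ∧
      ∀ a ∈ E v, ρ a ≤ ρ p := by
    intro v h
    refine ⟨(hmax v h).choose, ?_, (hmax v h).choose_spec⟩
    simp [par, h]
  have hrank : ∀ t, t ≠ none → rank (par t) < rank t := by
    rintro (_ | v) ht
    · exact absurd rfl ht
    · by_cases h : (E v).Nonempty
      · obtain ⟨p, hp, hpE, -⟩ := hpar v h
        rw [hp]
        exact WithBot.coe_lt_coe.2 hpE.2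
      · have : par (some v) = none := by simp [par, h]
        rw [this]
        exact WithBot.bot_lt_coe _
  have htree := parentGraph_isTree none par rank hrank
  have hconn : ∀ v : V, ∀ (o : O) (w : V), ρ w = o → v ∈ bag (some w) →
      ∃ h : v ∈ bag (some w), ∃ h' : v ∈ bag (some v),
      ((parentGraph none par).induce {t | v ∈ bag t}).Reachable ⟨some w, h⟩ ⟨some v, h'⟩ := by
    intro v o
    induction o using WellFoundedLT.induction with
    | _ o ih =>
      rintro w rfl hvw
      have hvv : v ∈ bag (some v) := Set.mem_insert _ _
      refine ⟨hvw, hvv, ?_⟩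
      by_cases hwv : w = v
      · subst hwv; exact Reachable.refl _
      · have hvE : v ∈ E w := hvw.resolve_left (Ne.symm hwv)
        obtain ⟨p, hp, hpE, hpm⟩ := hpar w ⟨v, hvE⟩
        have hvp : v ∈ bag (some p) := by
          by_cases hvp : v = p
          · exact .inl hvp
          · exact .inr ⟨hc w p v hpE.1 hvE.1 hpE.2 hvE.2 (Ne.symm hvp),
              lt_of_le_of_ne (hpm v hvE) fun h => hvp (hρ h)⟩
        obtain ⟨h1, h2, hr⟩ := ih (ρ p) hpE.2 p rfl hvp
        refine Reachable.trans (Adj.reachable ?_) hr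
        rw [comap_adj]
        change (parentGraph none par).Adj (some w) (some p)
        rw [parentGraph_adj]
        refine ⟨?_, .inl ⟨by simp, hp⟩⟩
        rintro ⟨⟩
        exact lt_irrefl _ hpE.2
  refine ⟨⟨Option V, parentGraph none par, htree, bag, fun v => ⟨some v, Set.mem_insert _ _⟩,
    ?_, ?_⟩, ?_⟩
  · intro v w hvw
    rcases lt_trichotomy (ρ v) (ρ w) with h | h | h
    · exact ⟨some w, .inr ⟨(hGH hvw).symm, h⟩, .inl rfl⟩
    · exact absurd (hρ h) hvw.ne
    · exact ⟨some v, .inl rfl, .inr ⟨hGH hvw, h⟩⟩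
  · intro v
    have hr : ∀ t : {t | v ∈ bag t}, ((parentGraph none par).induce {t | v ∈ bag t}).Reachable t
        ⟨some v, Set.mem_insert _ _⟩ := by
      rintro ⟨_ | w, hw⟩
      · exact absurd hw (Set.notMem_empty v)
      · obtain ⟨_, _, h⟩ := hconn v _ w rfl hw
        exact h
    have : Nonempty {t | v ∈ bag t} := ⟨⟨some v, Set.mem_insert _ _⟩⟩
    exact ⟨fun s t => (hr s).trans (hr t).symm⟩
  · rintro (_ | v)
    · simp [bag]
    · change (insert v (E v)).encard ≤ k
      rw [(hEf v).encard_eq_coe_toFinset_card]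
      exact_mod_cast hk _ (by simpa using hEc v)

theorem Elim.treewidthLT {V : Type u} {G H : SimpleGraph V} (hH : H.Elim) (hGH : G ≤ H) {k : ℕ}
    (hk : ∀ K : Finset V, H.IsClique K → K.card ≤ k) : G.TreewidthLT k := by
  obtain ⟨ρ, hρ, hc, -⟩ := hH.exists_rank hk (K := ∅) (by simp)
  exact treewidthLT_of_rank hGH hk ρ hρ hc

/-! ### Components of `G - X` and gluing along `X` -/

/-- `C` is the vertex set of a component of `G - X`. -/
structure IsCompAvoiding {V : Type u} (G : SimpleGraph V) (X C : Set V) : Prop where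
  connOn : G.ConnOn C
  disjoint : Disjoint C X
  closed : ∀ a ∈ C, ∀ b ∉ X, G.Adj a b → b ∈ C

theorem exists_isCompAvoiding {V : Type u} (G : SimpleGraph V) {X : Set V} {v : V} (hv : v ∉ X) :
    ∃ C, v ∈ C ∧ G.IsCompAvoiding X C := by
  let 𝒜 : Set (Set V) := {A | G.ConnOn A ∧ Disjoint A X ∧ v ∈ A}
  have hmem : {v} ∈ 𝒜 := ⟨connOn_singleton G v, by simpa using hv, rfl⟩
  refine ⟨⋃₀ 𝒜, ⟨_, hmem, rfl⟩, ?_, ?_, ?_⟩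
  · exact connOn_sUnion (v := v) ⟨_, hmem⟩ (fun A hA => hA.2.2) fun A hA => hA.1
  · exact Set.disjoint_sUnion_left.2 fun A hA => hA.2.1
  · rintro a ⟨A, ⟨hA, hAX, hvA⟩, haA⟩ b hb hab
    exact ⟨insert b A, ⟨hA.insert haA hab.symm, Set.disjoint_insert_left.2 ⟨hb, hAX⟩, .inr hvA⟩,
      .inl rfl⟩

theorem IsCompAvoiding.subset {V : Type u} {G : SimpleGraph V} {X C D : Set V} {v : V}
    (hC : G.IsCompAvoiding X C) (hD : G.IsCompAvoiding X D) (hvC : v ∈ C) (hvD : v ∈ D) :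
    C ⊆ D := by
  intro w hw
  by_contra hwD
  obtain ⟨a, -, haD, b, hb, hbD, hab⟩ := hC.connOn.2 D ⟨v, hvC, hvD⟩ ⟨w, hw, hwD⟩
  exact hbD (hD.closed a haD b (Set.disjoint_left.1 hC.disjoint hb) hab)

theorem IsCompAvoiding.eq {V : Type u} {G : SimpleGraph V} {X C D : Set V} {v : V}
    (hC : G.IsCompAvoiding X C) (hD : G.IsCompAvoiding X D) (hvC : v ∈ C) (hvD : v ∈ D) :
    C = D :=
  (hC.subset hD hvC hvD).antisymm (hD.subset hC hvD hvC)

/-- `H` is a chordal supergraph of `G` in which every clique with more than `k` vertices fails to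
cover `𝓑`. -/
structure IsAdmissible {V : Type u} (G : SimpleGraph V) (k : ℕ) (𝓑 : Set (Set V))
    (H : SimpleGraph V) : Prop where
  le : G ≤ H
  elim : H.Elim
  exists_disjoint : ∀ K : Finset V, H.IsClique K → k < K.card → ∃ B ∈ 𝓑, Disjoint (K : Set V) B

/-- `R` is a supergraph of `G[X ∪ C]`, together with a complete graph on `X`, which is chordal with
an elimination ordering ending in `X`, and in which every clique with more than `k` vertices fails
to cover `𝓑`. -/
structure IsLocallyAdmissible {V : Type u} (G : SimpleGraph V) (k : ℕ) (𝓑 : Set (Set V))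
    (X C : Set V) (R : SimpleGraph V) : Prop where
  mem : ∀ a b, R.Adj a b → a ∈ X ∪ C
  adj : ∀ a ∈ C, ∀ b, G.Adj a b → R.Adj a b
  isClique : R.IsClique X
  simplicial : ∀ F : Finset V, (∃ v ∈ F, v ∈ C) → ∃ v ∈ F, v ∈ C ∧ R.SimplicialIn F v
  exists_disjoint : ∀ K : Finset V, R.IsClique K → (K : Set V) ⊆ X ∪ C → k < K.card →
    ∃ B ∈ 𝓑, Disjoint (K : Set V) B

/-- The local graphs are united and `X` is made complete. Edges at a vertex of `C` come only from
the graph for `C`, so simplicial vertices there remain simplicial. A clique with more than `k`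
vertices does not fit into `X`, hence lives in a single `X ∪ C`. -/
theorem exists_isAdmissible_of_local {V : Type u} [Finite V] {G : SimpleGraph V} {k : ℕ}
    {𝓑 : Set (Set V)} {X : Set V} (hX : X.ncard ≤ k)
    (h : ∀ C, G.IsCompAvoiding X C → ∃ R, G.IsLocallyAdmissible k 𝓑 X C R) :
    ∃ H, G.IsAdmissible k 𝓑 H := by
  choose R hR using h
  let H : SimpleGraph V :=
    { Adj := fun a b => a ≠ b ∧ ((a ∈ X ∧ b ∈ X) ∨ ∃ C, ∃ hC : G.IsCompAvoiding X C,
        (R C hC).Adj a b)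
      symm := ⟨by
        rintro a b ⟨hab, h⟩
        refine ⟨hab.symm, h.imp And.symm ?_⟩
        rintro ⟨C, hC, h⟩
        exact ⟨C, hC, h.symm⟩⟩
      loopless := ⟨fun a h => h.1 rfl⟩ }
  have hRH : ∀ C hC, R C hC ≤ H := fun C hC a b hab => ⟨hab.ne, .inr ⟨C, hC, hab⟩⟩
  have hHR : ∀ C hC a b, H.Adj a b → a ∈ C → (R C hC).Adj a b := by
    rintro C hC a b ⟨-, ⟨ha, -⟩ | ⟨D, hD, hab⟩⟩ haC
    · exact absurd ha (Set.disjoint_left.1 hC.disjoint haC)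
    · have haD := ((hR D hD).mem a b hab).resolve_left (Set.disjoint_left.1 hC.disjoint haC)
      obtain rfl := hC.eq hD haC haD
      exact hab
  refine ⟨H, ?_, ?_, ?_⟩
  · intro a b hab
    by_cases ha : a ∈ X
    · by_cases hb : b ∈ X
      · exact ⟨hab.ne, .inl ⟨ha, hb⟩⟩
      · obtain ⟨C, hbC, hC⟩ := exists_isCompAvoiding G hb
        exact hRH C hC ((hR C hC).adj b hbC a hab.symm).symm
    · obtain ⟨C, haC, hC⟩ := exists_isCompAvoiding G ha
      exact hRH C hC ((hR C hC).adj a haC b hab)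
  · rintro F ⟨w, hw⟩
    by_cases hF : (F : Set V) ⊆ X
    · exact ⟨w, hw, fun a ha b hb _ _ hab => ⟨hab, .inl ⟨hF ha, hF hb⟩⟩⟩
    · obtain ⟨u, hu, huX⟩ := Set.not_subset.1 hF
      obtain ⟨C, huC, hC⟩ := exists_isCompAvoiding G huX
      obtain ⟨v, hv, hvC, hsim⟩ := (hR C hC).simplicial F ⟨u, hu, huC⟩
      exact ⟨v, hv, fun a ha b hb hva hvb hab =>
        hRH C hC (hsim a ha b hb (hHR C hC v a hva hvC) (hHR C hC v b hvb hvC) hab)⟩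
  · intro K hK hk
    have hKX : ¬ (K : Set V) ⊆ X := by
      intro hKX
      have := Set.ncard_le_ncard hKX (Set.toFinite X)
      rw [Set.ncard_coe_finset] at this
      omega
    obtain ⟨v, hv, hvX⟩ := Set.not_subset.1 hKX
    obtain ⟨C, hvC, hC⟩ := exists_isCompAvoiding G hvX
    have hKC : (K : Set V) ⊆ X ∪ C := by
      intro a ha
      by_cases hav : a = v
      · exact .inr (hav ▸ hvC)
      · exact (hR C hC).mem a v (hHR C hC v a (hK hv ha (Ne.symm hav)) hvC).symm
    refine (hR C hC).exists_disjoint K ?_ hKC hk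
    intro a ha b hb hab
    rcases hKC ha with haX | haC
    · rcases hKC hb with hbX | hbC
      · exact (hR C hC).isClique haX hbX hab
      · exact (hHR C hC b a (hK hb ha hab.symm) hbC).symm
    · exact hHR C hC a b (hK ha hb hab) haC

/-- `X` is made complete, and so is `C` together with its neighbours in `X`. A clique meeting `C`
lies in the latter set, which misses `B` as `C` does not touch `B`. -/
theorem exists_isLocallyAdmissible_of_not_touch {V : Type u} [Finite V] {G : SimpleGraph V} {k : ℕ}
    {𝓑 : Set (Set V)} {X C B : Set V} (hX : X.ncard ≤ k) (hC : G.IsCompAvoiding X C)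
    (hB : B ∈ 𝓑) (hCB : ¬ G.Touch C B) : ∃ R, G.IsLocallyAdmissible k 𝓑 X C R := by
  let D : Set V := {a | a ∈ C ∨ a ∈ X ∧ ∃ c ∈ C, G.Adj c a}
  let R : SimpleGraph V :=
    { Adj := fun a b => a ≠ b ∧ ((a ∈ X ∧ b ∈ X) ∨ (a ∈ D ∧ b ∈ D))
      symm := ⟨fun a b h => ⟨h.1.symm, h.2.imp And.symm And.symm⟩⟩
      loopless := ⟨fun a h => h.1 rfl⟩ }
  have hD : ∀ c ∈ C, ∀ a, R.Adj c a → a ∈ D := by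
    rintro c hc a ⟨-, ⟨h, -⟩ | ⟨-, h⟩⟩
    · exact absurd h (Set.disjoint_left.1 hC.disjoint hc)
    · exact h
  have hDB : Disjoint D B := by
    rw [Set.disjoint_left]
    rintro a (ha | ⟨-, c, hc, hca⟩) haB
    · exact hCB (.inl ⟨a, ha, haB⟩)
    · exact hCB (.inr ⟨c, hc, a, haB, hca⟩)
  refine ⟨R, ?_, ?_, ?_, ?_, ?_⟩
  · rintro a b ⟨-, ⟨h, -⟩ | ⟨h | h, -⟩⟩
    exacts [.inl h, .inr h, .inl h.1]
  · intro a ha b hab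
    refine ⟨hab.ne, .inr ⟨.inl ha, ?_⟩⟩
    by_cases hb : b ∈ X
    · exact .inr ⟨hb, a, ha, hab⟩
    · exact .inl (hC.closed a ha b hb hab)
  · exact fun a ha b hb hab => ⟨hab, .inl ⟨ha, hb⟩⟩
  · rintro F ⟨v, hv, hvC⟩
    exact ⟨v, hv, hvC, fun a _ b _ hva hvb hab => ⟨hab, .inr ⟨hD v hvC a hva, hD v hvC b hvb⟩⟩⟩
  · intro K hK hKC hk
    have hKX : ¬ (K : Set V) ⊆ X := by
      intro hKX
      have := Set.ncard_le_ncard hKX (Set.toFinite X)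
      rw [Set.ncard_coe_finset] at this
      omega
    obtain ⟨v, hv, hvX⟩ := Set.not_subset.1 hKX
    have hvC := (hKC hv).resolve_left hvX
    refine ⟨B, hB, hDB.mono_left fun a ha => ?_⟩
    by_cases hav : a = v
    · exact .inl (hav ▸ hvC)
    · exact hD v hvC a (hK hv ha (Ne.symm hav))

/-! ### The local graph for a component touching the whole bramble -/

/-- `Descends H ρ y c`: there is a path from `y` to `c` in `H` along which the rank decreases. -/
def Descends {V : Type u} (H : SimpleGraph V) {O : Type*} [LT O] (ρ : V → O) : V → V → Prop :=
  Relation.ReflTransGen fun y z => H.Adj y z ∧ ρ z < ρ y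

/-- Leaving the set of vertices descending to `c` leads to an earlier neighbour of `c`. -/
theorem Descends.boundary {V : Type u} {H : SimpleGraph V} {O : Type*} [LinearOrder O] {ρ : V → O}
    (hρ : Function.Injective ρ)
    (hc : ∀ v a b, H.Adj v a → H.Adj v b → ρ a < ρ v → ρ b < ρ v → a ≠ b → H.Adj a b) {y c : V}
    (h : H.Descends ρ y c) : ∀ z, H.Adj y z → ¬ H.Descends ρ z c → H.Adj c z ∧ ρ z < ρ c := by
  have hlt : ∀ y z, H.Descends ρ y c → H.Adj y z → ¬ H.Descends ρ z c → ρ z < ρ y := by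
    intro y z hy hyz hz
    rcases lt_trichotomy (ρ z) (ρ y) with h | h | h
    · exact h
    · exact absurd (hρ h).symm hyz.ne
    · exact absurd (Relation.ReflTransGen.head ⟨hyz.symm, h⟩ hy) hz
  induction h using Relation.ReflTransGen.head_induction_on with
  | refl => exact fun z hz hzc => ⟨hz, hlt _ z Relation.ReflTransGen.refl hz hzc⟩
  | head hs ht ih =>
    intro z hz hzc
    -- The next vertex of the descending path and `z` are both earlier neighbours of the current
    -- vertex, hence adjacent; so the exit `z` is passed down the path to `c`.
    refine ih z (hc _ _ _ hs.1 hz hs.2 (hlt _ z (Relation.ReflTransGen.head hs ht) hz hzc) ?_) hzc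
    rintro rfl
    exact hzc ht

/-- From an admissible graph for `𝓑 ∪ {C}` which is not admissible for `𝓑`, one obtains a locally
admissible graph for `𝓑` on the component `C`. -/
theorem exists_isLocallyAdmissible_of_isAdmissible {V : Type u} [Finite V] {G : SimpleGraph V}
    {k : ℕ} {𝓑 : Set (Set V)} {X C : Set V} (h𝓑 : ∀ B ∈ 𝓑, G.ConnOn B) (hX : X.ncard ≤ k)
    (hXc : Covers X 𝓑) (hXm : ∀ Y : Set V, Covers Y 𝓑 → X.ncard ≤ Y.ncard)
    (hC : G.IsCompAvoiding X C) {H : SimpleGraph V} (hH : G.IsAdmissible k (insert C 𝓑) H)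
    {K : Set V} (hK : H.IsClique K) (hKc : Covers K 𝓑) (hKC : Disjoint K C) :
    ∃ R, G.IsLocallyAdmissible k 𝓑 X C R := by
  classical
  obtain ⟨ρ, hρ, hcl, hKρ⟩ := hH.elim.exists_rank (n := Nat.card V) (fun S _ => by
    rw [← Set.ncard_coe_finset, ← Set.ncard_univ]
    exact Set.ncard_le_ncard (Set.subset_univ _) (Set.toFinite _)) hK
  have hCX : ∀ {c}, c ∈ C → c ∉ X := fun hc => Set.disjoint_left.1 hC.disjoint hc
  -- Each `x ∈ X` is also joined to all vertices of `C` to which it descends. In terms of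
  -- tree-decompositions, with `K` as root, `x` is added to bags on its way to the root.
  let R : SimpleGraph V :=
    { Adj := fun a b => a ≠ b ∧ (a ∈ X ∪ C ∧ b ∈ X ∪ C) ∧ ((a ∈ X ∧ b ∈ X) ∨ H.Adj a b ∨
        (a ∈ X ∧ b ∈ C ∧ H.Descends ρ a b) ∨ (b ∈ X ∧ a ∈ C ∧ H.Descends ρ b a))
      symm := ⟨fun a b h => ⟨h.1.symm, h.2.1.symm, by
        rcases h.2.2 with h | h | h | h
        exacts [.inl h.symm, .inr (.inl h.symm), .inr (.inr (.inr h)), .inr (.inr (.inl h))]⟩⟩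
      loopless := ⟨fun a h => h.1 rfl⟩ }
  have hRC : ∀ c ∈ C, ∀ d ∈ C, R.Adj c d → H.Adj c d := by
    rintro c hc d hd ⟨-, -, h | h | h | h⟩
    exacts [absurd h.1 (hCX hc), h, absurd h.1 (hCX hc), absurd h.1 (hCX hd)]
  have hRX : ∀ c ∈ C, ∀ x ∈ X, R.Adj c x → (H.Adj c x ∧ ρ x < ρ c) ∨ H.Descends ρ x c := by
    rintro c hc x hx ⟨hne, -, h | h | h | h⟩
    · exact absurd h.1 (hCX hc)
    · rcases lt_trichotomy (ρ x) (ρ c) with hlt | heq | hlt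
      · exact .inl ⟨h, hlt⟩
      · exact absurd (hρ heq).symm hne
      · exact .inr (Relation.ReflTransGen.single ⟨h.symm, hlt⟩)
    · exact absurd h.1 (hCX hc)
    · exact .inr h.2.2
  refine ⟨R, fun a b h => h.2.1.1, ?_, ?_, ?_, ?_⟩
  · intro a ha b hab
    refine ⟨hab.ne, ⟨.inr ha, ?_⟩, .inr (.inl (hH.le hab))⟩
    by_cases hb : b ∈ X
    · exact .inl hb
    · exact .inr (hC.closed a ha b hb hab)
  · exact fun a ha b hb hab => ⟨hab, ⟨.inl ha, .inl hb⟩, .inl ⟨ha, hb⟩⟩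
  · rintro F ⟨v₀, hv₀, hv₀C⟩
    obtain ⟨v, ⟨hvF, hvC⟩, hmax⟩ := Set.exists_max_image ((F : Set V) ∩ C) ρ (Set.toFinite _)
      ⟨v₀, hv₀, hv₀C⟩
    have hlt : ∀ d ∈ F, d ∈ C → R.Adj v d → ρ d < ρ v := fun d hd hdC hvd =>
      lt_of_le_of_ne (hmax d ⟨hd, hdC⟩) fun h => hvd.1 (hρ h).symm
    have key : ∀ d ∈ F, d ∈ C → R.Adj v d → ∀ x ∈ X, R.Adj v x → R.Adj d x := by
      intro d hd hdC hvd x hx hvx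
      have hdx : d ≠ x := fun h => hCX hdC (h ▸ hx)
      have hvd' := hRC v hvC d hdC hvd
      refine ⟨hdx, ⟨.inr hdC, .inl hx⟩, ?_⟩
      rcases hRX v hvC x hx hvx with h | h
      · exact .inr (.inl (hcl v d x hvd' h.1 (hlt d hd hdC hvd) h.2 hdx))
      · exact .inr (.inr (.inr ⟨hx, hdC, h.tail ⟨hvd', hlt d hd hdC hvd⟩⟩))
    refine ⟨v, hvF, hvC, fun a ha b hb hva hvb hab => ?_⟩
    rcases hva.2.1.2 with haX | haC
    · rcases hvb.2.1.2 with hbX | hbC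
      · exact ⟨hab, ⟨.inl haX, .inl hbX⟩, .inl ⟨haX, hbX⟩⟩
      · exact (key b hb hbC hvb a haX hva).symm
    · rcases hvb.2.1.2 with hbX | hbC
      · exact key a ha haC hva b hbX hvb
      · exact ⟨hab, ⟨.inr haC, .inr hbC⟩, .inr (.inl (hcl v a b (hRC v hvC a haC hva)
          (hRC v hvC b hbC hvb) (hlt a ha haC hva) (hlt b hb hbC hvb) hab))⟩
  · intro K' hK' hK'C hk
    have hK'X : ¬ (K' : Set V) ⊆ X := by
      intro hKX
      have := Set.ncard_le_ncard hKX (Set.toFinite X)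
      rw [Set.ncard_coe_finset] at this
      omega
    obtain ⟨v, hv, hvX⟩ := Set.not_subset.1 hK'X
    obtain ⟨c, ⟨hcK, hcC⟩, hmax⟩ := Set.exists_max_image ((K' : Set V) ∩ C) ρ (Set.toFinite _)
      ⟨v, hv, (hK'C hv).resolve_left hvX⟩
    -- The `H`-clique `E` stands in for the `R`-clique `K'`: it contains `K' ∩ C`, and the vertices
    -- of `K' ∩ X` outside it descend to `c`.
    let E : Set V := insert c {a | H.Adj c a ∧ ρ a < ρ c}
    have hEc : H.IsClique E := by
      rw [isClique_insert]
      exact ⟨fun a ha b hb hab => hcl c a b ha.1 hb.1 ha.2 hb.2 hab, fun b hb _ => hb.1⟩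
    have hDE : (K' : Set V) ∩ C ⊆ E ∩ C := by
      rintro d ⟨hd, hdC⟩
      refine ⟨?_, hdC⟩
      by_cases hdc : d = c
      · exact .inl hdc
      · exact .inr ⟨hRC c hcC d hdC (hK' hcK hd (Ne.symm hdc)),
          lt_of_le_of_ne (hmax d ⟨hd, hdC⟩) fun h => hdc (hρ h)⟩
    have hXE : ∀ x ∈ K', x ∈ X → x ∈ E ∨ H.Descends ρ x c := by
      intro x hx hxX
      have hcx : c ≠ x := fun h => hCX hcC (h ▸ hxX)
      exact (hRX c hcC x hxX (hK' hcK hx hcx)).imp .inr id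
    -- As `K` is initial in the ranking, descending from `K` never leaves `K`, so it cannot end at
    -- `c ∈ C`.
    have hKd : ∀ z ∈ K, ¬ H.Descends ρ z c := by
      intro z hz hzc
      have : ∀ y, H.Descends ρ z y → y ∈ K := by
        intro y hy
        induction hy with
        | refl => exact hz
        | tail _ hs ih =>
          by_contra hb
          exact lt_asymm hs.2 (hKρ _ ih _ hb)
      exact Set.disjoint_left.1 hKC (this c hzc) hcC
    have hbd : ∀ y z, G.Adj y z → H.Descends ρ y c → ¬ H.Descends ρ z c → z ∈ E :=
      fun y z hyz hy hz => .inr (hy.boundary hρ hcl z (hH.le hyz) hz)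
    -- In `X`, the part in `K'` is exchanged for `E \ C`. If `B ∈ 𝓑` missed `Y`, all its vertices in
    -- `X` would descend to `c`; as `B` also meets `K`, it has an edge leaving the union of `C` and
    -- the vertices descending to `c`. Leaving from `C` leads into `X`, and leaving from a
    -- descending vertex leads into `E \ C`; both are impossible.
    let Y : Set V := (E \ C) ∪ (X \ K')
    have hY : Covers Y 𝓑 := by
      intro B hB
      by_contra hne
      have hYB : ∀ y ∈ B, y ∉ Y := fun y hyB hyY => hne ⟨y, hyY, hyB⟩
      have hBX : ∀ x ∈ B, x ∈ X → H.Descends ρ x c := by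
        intro x hxB hxX
        have hxK : x ∈ K' := by
          by_contra h
          exact hYB x hxB (.inr ⟨hxX, h⟩)
        refine (hXE x hxK hxX).resolve_left fun hxE => hYB x hxB (.inl ⟨hxE, ?_⟩)
        exact fun hxC => hCX hxC hxX
      obtain ⟨x, hxX, hxB⟩ := hXc B hB
      obtain ⟨z, hzK, hzB⟩ := hKc B hB
      obtain ⟨y, hy, hyQ, y', hy', hyQ', hadj⟩ := (h𝓑 B hB).2 {y | y ∈ C ∨ H.Descends ρ y c}
        ⟨x, hxB, .inr (hBX x hxB hxX)⟩
        ⟨z, hzB, fun h => h.elim (Set.disjoint_left.1 hKC hzK) (hKd z hzK)⟩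
      rw [Set.mem_ofPred_eq, not_or] at hyQ'
      rcases hyQ with hyC | hyd
      · refine hyQ'.1 (hC.closed y hyC y' (fun h => hyQ'.2 (hBX y' hy' h)) hadj)
      · exact hYB y' hy' (.inl ⟨hbd y y' hadj hyd hyQ'.2, hyQ'.1⟩)
    -- Minimality of `X` against `Y` gives `|X ∩ K'| ≤ |E \ C|`, so `E` is at least as large as
    -- `K'`.
    have hEk : k < E.ncard := by
      have h1 := hXm Y hY
      have h2 : Y.ncard ≤ (E \ C).ncard + (X \ K').ncard := Set.ncard_union_le _ _
      have h3 : (X \ K').ncard + (X ∩ K').ncard = X.ncard := by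
        rw [add_comm]; exact Set.ncard_inter_add_ncard_sdiff_eq_ncard X _ (Set.toFinite _)
      have h4 : (E ∩ C).ncard + (E \ C).ncard = E.ncard :=
        Set.ncard_inter_add_ncard_sdiff_eq_ncard E C (Set.toFinite _)
      have h5 : ((K' : Set V) ∩ C).ncard ≤ (E ∩ C).ncard :=
        Set.ncard_le_ncard hDE (Set.toFinite _)
      have h6 : (K' : Set V) = ((K' : Set V) ∩ C) ∪ (X ∩ K') := by
        ext a
        have := @hK'C a
        simp only [Set.mem_union, Set.mem_inter_iff] at this ⊢
        tauto
      have h7 : (K' : Set V).ncard ≤ ((K' : Set V) ∩ C).ncard + (X ∩ K').ncard := by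
        conv_lhs => rw [h6]
        exact Set.ncard_union_le _ _
      rw [Set.ncard_coe_finset] at h7
      omega
    obtain ⟨B, hB, hEB⟩ := hH.exists_disjoint (Set.toFinite E).toFinset (by rwa [Set.Finite.coe_toFinset])
      (by rwa [← Set.ncard_eq_toFinset_card])
    rw [Set.Finite.coe_toFinset] at hEB
    have hcE : c ∈ E := .inl rfl
    have hB' : B ∈ 𝓑 := by
      rcases hB with rfl | hB
      · exact absurd hcC (Set.disjoint_left.1 hEB hcE)
      · exact hB
    -- A common vertex of `K'` and `B` outside `E` would descend to `c`; since `B` also meets `K`,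
    -- some edge inside `B` would leave the descending vertices, and it would end in `E`.
    refine ⟨B, hB', Set.disjoint_left.2 fun w hwK hwB => ?_⟩
    have hwE : w ∉ E := fun h => Set.disjoint_left.1 hEB h hwB
    rcases hK'C hwK with hwX | hwC
    · have hwd := (hXE w hwK hwX).resolve_left hwE
      obtain ⟨z, hzK, hzB⟩ := hKc B hB'
      obtain ⟨y, hy, hyQ, y', hy', hyQ', hadj⟩ := (h𝓑 B hB').2 {y | H.Descends ρ y c}
        ⟨w, hwB, hwd⟩ ⟨z, hzB, hKd z hzK⟩
      exact Set.disjoint_left.1 hEB (hbd y y' hadj hyQ hyQ') hy'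
    · exact hwE (hDE ⟨hwK, hwC⟩).1

/-! ### Duality for finite graphs -/

theorem Touch.symm {V : Type u} {G : SimpleGraph V} {A B : Set V} (h : G.Touch A B) :
    G.Touch B A := by
  rcases h with ⟨x, hA, hB⟩ | ⟨a, ha, b, hb, hab⟩
  · exact .inl ⟨x, hB, hA⟩
  · exact .inr ⟨b, hb, a, ha, hab.symm⟩

/-- Induction from larger to smaller brambles, well-founded as `V` is finite. Adding `C` enlarges
`𝓑` properly, since the cover `X` misses `C`. A graph admissible for the larger bramble but not for
`𝓑` has a clique with more than `k` vertices that covers `𝓑`, and this clique must then miss `C`. -/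
theorem exists_isAdmissible {V : Type u} [Finite V] {G : SimpleGraph V} {k : ℕ}
    (hG : ∀ 𝓑, G.IsBramble 𝓑 → ∃ X : Set V, Covers X 𝓑 ∧ X.ncard ≤ k) (𝓑 : Set (Set V))
    (h𝓑 : G.IsBramble 𝓑) : ∃ H, G.IsAdmissible k 𝓑 H := by
  induction 𝓑 using WellFoundedGT.induction with
  | _ 𝓑 ih =>
    by_contra hno
    obtain ⟨X, hXc, hXm⟩ := Set.exists_min_image {X : Set V | Covers X 𝓑} Set.ncard
      (Set.toFinite _) ((hG 𝓑 h𝓑).imp fun X h => h.1)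
    obtain ⟨X', hX'c, hX'k⟩ := hG 𝓑 h𝓑
    have hX : X.ncard ≤ k := (hXm X' hX'c).trans hX'k
    refine hno (exists_isAdmissible_of_local hX fun C hC => ?_)
    by_cases ht : ∀ B ∈ 𝓑, G.Touch C B
    · have hCt : G.Touch C C := by
        obtain ⟨c, hc⟩ := hC.connOn.1
        exact .inl ⟨c, hc, hc⟩
      have hb : G.IsBramble (insert C 𝓑) := by
        refine ⟨?_, ?_⟩
        · rintro A (rfl | hA)
          · exact connOn_iff_induce_connected.1 hC.connOn
          · exact h𝓑.connected A hA
        · rintro A (rfl | hA) B (rfl | hB)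
          · exact hCt
          · exact ht B hB
          · exact (ht A hA).symm
          · exact h𝓑.touch A hA B hB
      have hlt : 𝓑 < insert C 𝓑 := by
        refine Set.ssubset_insert fun hmem => ?_
        obtain ⟨x, hxX, hxC⟩ := hXc C hmem
        exact Set.disjoint_left.1 hC.disjoint hxC hxX
      obtain ⟨H, hH⟩ := ih _ hlt hb
      have hK : ∃ K : Finset V, H.IsClique K ∧ k < K.card ∧
          ∀ B ∈ 𝓑, ¬ Disjoint (K : Set V) B := by
        by_contra! h
        exact hno ⟨H, hH.le, hH.elim, h⟩
      obtain ⟨K, hKc, hKk, hKB⟩ := hK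
      obtain ⟨B, hB, hKd⟩ := hH.exists_disjoint K hKc hKk
      have hBC : B = C := hB.resolve_right fun h => hKB B h hKd
      subst hBC
      exact exists_isLocallyAdmissible_of_isAdmissible
        (fun B hB => connOn_iff_induce_connected.2 (h𝓑.connected B hB)) hX hXc hXm hC hH hKc
        (fun B hB => Set.not_disjoint_iff_nonempty_inter.1 (hKB B hB)) hKd
    · push Not at ht
      obtain ⟨B, hB, hCB⟩ := ht
      exact exists_isLocallyAdmissible_of_not_touch hX hC hB hCB

/-- Treewidth duality for finite graphs, in terms of chordal supergraphs. -/
theorem exists_elim_of_forall_isBramble {V : Type u} [Finite V] {G : SimpleGraph V} {k : ℕ}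
    (hG : ∀ 𝓑, G.IsBramble 𝓑 → ∃ X : Set V, Covers X 𝓑 ∧ X.ncard ≤ k) :
    ∃ H, G ≤ H ∧ H.Elim ∧ ∀ K : Finset V, H.IsClique K → K.card ≤ k := by
  -- The empty bramble has no element to miss, so a clique with more than `k` vertices cannot exist.
  obtain ⟨H, hH⟩ := exists_isAdmissible hG ∅ ⟨by simp, by simp⟩
  refine ⟨H, hH.le, hH.elim, fun K hK => ?_⟩
  by_contra! h
  obtain ⟨B, hB, -⟩ := hH.exists_disjoint K hK h
  exact hB

/-! ### Compactness, for chordal supergraphs and for covers -/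

theorem brambleOrder_le_iff {V : Type u} {𝓑 : Set (Set V)} {k : ℕ} :
    brambleOrder 𝓑 ≤ k ↔ ∃ X : Set V, Covers X 𝓑 ∧ X.encard ≤ k := by
  constructor
  · intro h
    by_contra! hno
    have : ((k + 1 : ℕ) : ℕ∞) ≤ brambleOrder 𝓑 := by
      refine le_iInf₂ fun X hX => ?_
      have := Order.add_one_le_of_lt (hno X hX)
      exact_mod_cast this
    have := this.trans h
    norm_cast at this
    omega
  · rintro ⟨X, hX, hk⟩
    exact (iInf₂_le X hX).trans hk

theorem ConnOn.image_val {V : Type u} {G : SimpleGraph V} {F : Set V} {A : Set F}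
    (h : (G.induce F).ConnOn A) : G.ConnOn (Subtype.val '' A) := by
  refine ⟨h.1.image _, ?_⟩
  rintro Q ⟨_, ⟨x, hx, rfl⟩, hxQ⟩ ⟨_, ⟨y, hy, rfl⟩, hyQ⟩
  obtain ⟨a, ha, haQ, b, hb, hbQ, hab⟩ := h.2 (Subtype.val ⁻¹' Q) ⟨x, hx, hxQ⟩ ⟨y, hy, hyQ⟩
  exact ⟨a, ⟨a, ha, rfl⟩, haQ, b, ⟨b, hb, rfl⟩, hbQ, by simpa using hab⟩

theorem IsBramble.image_val {V : Type u} {G : SimpleGraph V} {F : Set V} {𝓑 : Set (Set F)}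
    (h : (G.induce F).IsBramble 𝓑) : G.IsBramble (Set.image Subtype.val '' 𝓑) := by
  refine ⟨?_, ?_⟩
  · rintro _ ⟨A, hA, rfl⟩
    exact connOn_iff_induce_connected.1
      (connOn_iff_induce_connected.2 (h.connected A hA)).image_val
  · rintro _ ⟨A, hA, rfl⟩ _ ⟨B, hB, rfl⟩
    rcases h.touch A hA B hB with ⟨x, hx, hx'⟩ | ⟨a, ha, b, hb, hab⟩
    · exact .inl ⟨x, ⟨x, hx, rfl⟩, ⟨x, hx', rfl⟩⟩
    · exact .inr ⟨a, ⟨a, ha, rfl⟩, b, ⟨b, hb, rfl⟩, by simpa using hab⟩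

/-- If `G` has no finite bramble of order `> k`, every finite set of vertices carries a chordal
supergraph of `G` with cliques of size at most `k`. -/
theorem exists_elim_on_finset {V : Type u} {G : SimpleGraph V} {k : ℕ}
    (hG : ∀ 𝓑, G.IsFiniteBramble 𝓑 → brambleOrder 𝓑 ≤ k) (F : Finset V) :
    ∃ H : SimpleGraph V, (∀ x ∈ F, ∀ y ∈ F, G.Adj x y → H.Adj x y) ∧
      (∀ S ⊆ F, S.Nonempty → ∃ v ∈ S, H.SimplicialIn S v) ∧
      ∀ K ⊆ F, H.IsClique (K : Set V) → K.card ≤ k := by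
  classical
  have hF : ∀ 𝓑, (G.induce (F : Set V)).IsBramble 𝓑 →
      ∃ X : Set (F : Set V), Covers X 𝓑 ∧ X.ncard ≤ k := by
    intro 𝓑 h𝓑
    obtain ⟨X, hX, hXk⟩ := brambleOrder_le_iff.1 (hG _ ⟨h𝓑.image_val, by
      rintro _ ⟨A, hA, rfl⟩
      exact (Set.toFinite A).image _⟩)
    refine ⟨Subtype.val ⁻¹' X, ?_, ?_⟩
    · intro A hA
      obtain ⟨_, hx, ⟨x, hxA, rfl⟩⟩ := hX _ ⟨A, hA, rfl⟩
      exact ⟨x, hx, hxA⟩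
    · have h1 : ((Subtype.val ⁻¹' X : Set (F : Set V)).encard : ℕ∞) ≤ k := by
        rw [← Subtype.val_injective.encard_image]
        exact (Set.encard_le_encard (Set.image_preimage_subset _ _)).trans hXk
      rw [← (Set.toFinite _).cast_ncard_eq] at h1
      exact_mod_cast h1
  obtain ⟨H₀, hle, hel, hcl⟩ := exists_elim_of_forall_isBramble hF
  let H : SimpleGraph V := H₀.map (Function.Embedding.subtype _)
  have hadj : ∀ x y : (F : Set V), H.Adj x y ↔ H₀.Adj x y := fun x y =>
    map_adj_apply (f := Function.Embedding.subtype _)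
  have lift : ∀ S ⊆ F, ∃ S' : Finset (F : Set V), S = S'.map (Function.Embedding.subtype _) :=
    fun S hS => ⟨S.subtype (· ∈ (F : Set V)), by
      rw [Finset.subtype_map]; exact (Finset.filter_true_of_mem fun x hx => hS hx).symm⟩
  refine ⟨H, ?_, ?_, ?_⟩
  · intro x hx y hy hxy
    exact (hadj ⟨x, hx⟩ ⟨y, hy⟩).2 (hle (by simpa using hxy))
  · intro S hS hne
    obtain ⟨S', rfl⟩ := lift S hS
    obtain ⟨v, hv, hsim⟩ := hel S' (Finset.map_nonempty.1 hne)
    refine ⟨v, Finset.mem_map_of_mem _ hv, ?_⟩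
    intro a ha b hb hva hvb hab
    obtain ⟨a, ha', rfl⟩ := Finset.mem_map.1 ha
    obtain ⟨b, hb', rfl⟩ := Finset.mem_map.1 hb
    exact (hadj a b).2 (hsim a ha' b hb' ((hadj _ _).1 hva) ((hadj _ _).1 hvb)
      fun h => hab (h ▸ rfl))
  · intro K hK hKc
    obtain ⟨K', rfl⟩ := lift K hK
    rw [Finset.card_map]
    refine hcl K' fun a ha b hb hab => (hadj a b).1 (hKc ?_ ?_ fun h => hab (Subtype.ext h))
    · exact Finset.mem_map_of_mem _ ha
    · exact Finset.mem_map_of_mem _ hb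

/-- In the limit, `x` and `y` are adjacent if they are so for almost all `F`, in an ultrafilter
containing every set `{F | S ⊆ F}`. On each finite `S` the limit agrees with the graph of some `F ⊇
S`, and every required property concerns finite sets only. -/
theorem exists_elim_of_finset {V : Type u} {G : SimpleGraph V} {k : ℕ}
    (h : ∀ F : Finset V, ∃ H : SimpleGraph V, (∀ x ∈ F, ∀ y ∈ F, G.Adj x y → H.Adj x y) ∧
      (∀ S ⊆ F, S.Nonempty → ∃ v ∈ S, H.SimplicialIn S v) ∧
      ∀ K ⊆ F, H.IsClique (K : Set V) → K.card ≤ k) :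
    ∃ H, G ≤ H ∧ H.Elim ∧ ∀ K : Finset V, H.IsClique K → K.card ≤ k := by
  classical
  choose h' hG hS hK using h
  let 𝓤 : Ultrafilter (Finset V) := Ultrafilter.of Filter.atTop
  have h𝓤 : (𝓤 : Filter (Finset V)) ≤ Filter.atTop := Ultrafilter.of_le _
  let H : SimpleGraph V :=
    { Adj := fun x y => ∀ᶠ F in (𝓤 : Filter (Finset V)), (h' F).Adj x y
      symm := ⟨fun x y hxy => hxy.mono fun F hF => hF.symm⟩
      loopless := ⟨fun x hx => by
        obtain ⟨F, hF⟩ := hx.exists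
        exact hF.ne rfl⟩ }
  have key : ∀ S : Finset V, ∃ F, S ⊆ F ∧ ∀ x ∈ S, ∀ y ∈ S, (h' F).Adj x y ↔ H.Adj x y := by
    intro S
    have h1 : ∀ᶠ F in (𝓤 : Filter (Finset V)), S ⊆ F := h𝓤 (Filter.eventually_ge_atTop S)
    have h2 : ∀ᶠ F in (𝓤 : Filter (Finset V)), ∀ x ∈ S, ∀ y ∈ S,
        (h' F).Adj x y ↔ H.Adj x y := by
      rw [Filter.eventually_all_finset]
      intro x _
      rw [Filter.eventually_all_finset]
      intro y _
      by_cases hxy : H.Adj x y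
      · exact Filter.Eventually.mono hxy fun F hF => iff_of_true hF hxy
      · exact (Ultrafilter.eventually_not.2 hxy).mono fun F hF => iff_of_false hF hxy
    exact (h1.and h2).exists
  refine ⟨H, ?_, ?_, ?_⟩
  · intro x y hxy
    obtain ⟨F, hF, hFH⟩ := key {x, y}
    exact (hFH x (by simp) y (by simp)).1 (hG F x (hF (by simp)) y (hF (by simp)) hxy)
  · intro S hne
    obtain ⟨F, hF, hFH⟩ := key S
    obtain ⟨v, hv, hsim⟩ := hS F S hF hne
    exact ⟨v, hv, fun a ha b hb hva hvb hab => (hFH a ha b hb).1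
      (hsim a ha b hb ((hFH v hv a ha).2 hva) ((hFH v hv b hb).2 hvb) hab)⟩
  · intro K hKc
    obtain ⟨F, hF, hFH⟩ := key K
    exact hK F K hF fun a ha b hb hab => (hFH a ha b hb).2 (hKc ha hb hab)

/-- For `k + 1`, some `b` in a fixed element `A₀` can be put into the cover, leaving for the sets
avoiding `b` the same problem with `k`. Otherwise each `b ∈ A₀` has a finite subfamily refuting
this; as `A₀` is finite, these together with `A₀` form a finite family, and removing from a cover of
it a vertex `b ∈ A₀` gives a contradiction. -/
theorem exists_cover_of_finite_subfamilies {V : Type u} (k : ℕ) :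
    ∀ 𝓑 : Set (Set V), (∀ A ∈ 𝓑, A.Finite) →
    (∀ 𝓕 ⊆ 𝓑, 𝓕.Finite → ∃ X : Set V, Covers X 𝓕 ∧ X.encard ≤ k) →
    ∃ X : Set V, Covers X 𝓑 ∧ X.encard ≤ k := by
  induction k with
  | zero =>
    intro 𝓑 _ h
    refine ⟨∅, fun A hA => ?_, by simp⟩
    obtain ⟨X, hX, hX0⟩ := h {A} (by simpa using hA) (Set.finite_singleton A)
    have : X = ∅ := by simpa using hX0
    rw [← this]
    exact hX A rfl
  | succ k ih =>
    intro 𝓑 hfin h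
    by_cases hne : 𝓑.Nonempty
    swap
    · rw [Set.not_nonempty_iff_eq_empty] at hne
      subst hne
      exact ⟨∅, fun A hA => absurd hA (Set.notMem_empty A), by simp⟩
    obtain ⟨A₀, hA₀⟩ := hne
    have hb : ∃ b ∈ A₀, ∀ 𝓕 ⊆ {A ∈ 𝓑 | b ∉ A}, 𝓕.Finite →
        ∃ X : Set V, Covers X 𝓕 ∧ X.encard ≤ k := by
      by_contra! hcon
      choose! 𝓕 h𝓕 h𝓕f h𝓕X using hcon
      obtain ⟨X, hX, hXk⟩ := h (insert A₀ (⋃ b ∈ A₀, 𝓕 b)) (by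
        refine Set.insert_subset hA₀ (Set.iUnion₂_subset fun b hb => ?_)
        exact (h𝓕 b hb).trans (Set.sep_subset _ _)) (((hfin A₀ hA₀).biUnion h𝓕f).insert _)
      obtain ⟨b, hbX, hbA⟩ := hX A₀ (Set.mem_insert _ _)
      refine (h𝓕X b hbA (X \ {b}) fun A hA => ?_).not_ge ?_
      · obtain ⟨x, hxX, hxA⟩ := hX A (.inr (Set.mem_biUnion hbA hA))
        refine ⟨x, ⟨hxX, ?_⟩, hxA⟩
        rintro rfl
        exact (h𝓕 x hbA hA).2 hxA
      · have := Set.encard_sdiff_singleton_add_one hbX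
        rw [← this] at hXk
        push_cast at hXk
        exact (ENat.add_le_add_iff_right (by simp)).1 hXk
    obtain ⟨b, hbA, hb⟩ := hb
    obtain ⟨X, hX, hXk⟩ := ih {A ∈ 𝓑 | b ∉ A} (fun A hA => hfin A hA.1) hb
    refine ⟨insert b X, fun A hA => ?_, ?_⟩
    · by_cases hbA' : b ∈ A
      · exact ⟨b, .inl rfl, hbA'⟩
      · obtain ⟨x, hx, hxA⟩ := hX A ⟨hA, hbA'⟩
        exact ⟨x, .inr hx, hxA⟩
    · refine (Set.encard_insert_le _ _).trans ?_
      push_cast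
      gcongr

/-! ### The Helly property in trees -/

/-- A set of vertices is convex if it contains all paths between its vertices. -/
def PathConvex {V : Type u} (T : SimpleGraph V) (S : Set V) : Prop :=
  ∀ x ∈ S, ∀ y ∈ S, ∀ p : T.Walk x y, p.IsPath → ∀ z ∈ p.support, z ∈ S

theorem IsAcyclic.support_subset_of_isPath {V : Type u} {T : SimpleGraph V} (hT : T.IsAcyclic)
    {x y : V} {p : T.Walk x y} (hp : p.IsPath) (w : T.Walk x y) : p.support ⊆ w.support := by
  classical
  have h : (⟨p, hp⟩ : T.Path x y) = ⟨w.bypass, w.bypass_isPath⟩ := (hT.subsingleton_path x y).elim _ _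
  have h' : p = w.bypass := congrArg Subtype.val h
  rw [h']
  exact w.support_bypass_subset_support

theorem ConnOn.pathConvex {V : Type u} {T : SimpleGraph V} (hT : T.IsAcyclic) {S : Set V}
    (h : T.ConnOn S) : T.PathConvex S := by
  intro x hx y hy p hp z hz
  obtain ⟨w⟩ := (connOn_iff_induce_connected.1 h).preconnected ⟨x, hx⟩ ⟨y, hy⟩
  have hz' := hT.support_subset_of_isPath hp (w.map (Embedding.induce S).toHom) hz
  obtain ⟨a, -, rfl⟩ := List.mem_map.1 ((Walk.support_map _ w) ▸ hz')
  exact a.2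

theorem PathConvex.inter {V : Type u} {T : SimpleGraph V} {A B : Set V} (hA : T.PathConvex A)
    (hB : T.PathConvex B) : T.PathConvex (A ∩ B) :=
  fun x hx y hy p hp z hz => ⟨hA x hx.1 y hy.1 p hp z hz, hB x hx.2 y hy.2 p hp z hz⟩

/-- Where the walk steps from `x ∈ B` to `x' ∉ B`, the path from `x` to `a` stays in `B` and avoids
`x'`. Prefixing `x'` gives a path between vertices of `A` through `x`, so `x ∈ A`. -/
theorem PathConvex.exists_mem_inter_of_walk {V : Type u} {T : SimpleGraph V} (hT : T.Connected)
    {A B : Set V} (hA : T.PathConvex A) (hB : T.PathConvex B) {a : V} (haA : a ∈ A) (haB : a ∈ B)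
    {x y : V} (p : T.Walk x y) (hp : ∀ z ∈ p.support, z ∈ A ∨ z ∈ B) (hx : x ∈ B) (hy : y ∈ A) :
    ∃ m ∈ p.support, m ∈ A ∧ m ∈ B := by
  induction p with
  | nil => exact ⟨_, by simp, hy, hx⟩
  | @cons x x' y h p ih =>
    by_cases hx' : x' ∈ B
    · obtain ⟨m, hm, h1⟩ := ih (fun z hz => hp z (by simp [hz])) hx' hy
      exact ⟨m, by simp [hm], h1⟩
    · have hxA' : x' ∈ A := (hp x' (by simp)).resolve_right hx'
      obtain ⟨q, hq⟩ := (hT.preconnected x a).exists_isPath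
      have hq' : (Walk.cons h.symm q).IsPath :=
        hq.cons fun hmem => hx' (hB x hx a haB q hq x' hmem)
      exact ⟨x, by simp, hA x' hxA' a haA _ hq' x (by simp), hx⟩

/-- Three pairwise intersecting convex sets of vertices of a tree have a common vertex. -/
theorem IsTree.inter_inter_nonempty {V : Type u} {T : SimpleGraph V} (hT : T.IsTree) {A B C : Set V}
    (hA : T.PathConvex A) (hB : T.PathConvex B) (hC : T.PathConvex C) (hAB : (A ∩ B).Nonempty)
    (hAC : (A ∩ C).Nonempty) (hBC : (B ∩ C).Nonempty) : (A ∩ B ∩ C).Nonempty := by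
  obtain ⟨a, haA, haB⟩ := hAB
  obtain ⟨b, hbB, hbC⟩ := hBC
  obtain ⟨c, hcA, hcC⟩ := hAC
  obtain ⟨p, hp⟩ := (hT.connected.preconnected b c).exists_isPath
  obtain ⟨q, hq⟩ := (hT.connected.preconnected b a).exists_isPath
  obtain ⟨r, hr⟩ := (hT.connected.preconnected a c).exists_isPath
  -- The path from `b` to `c` is contained in the walk via `a`, hence in `A ∪ B`; by convexity it
  -- also lies in `C`.
  obtain ⟨m, hm, hmA, hmB⟩ := hA.exists_mem_inter_of_walk hT.connected hB haA haB p
    (fun z hz => by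
      have hz' := hT.isAcyclic.support_subset_of_isPath hp (q.append r) hz
      rw [Walk.mem_support_append_iff] at hz'
      exact hz'.symm.imp (hA a haA c hcA r hr z) (hB b hbB a haB q hq z)) hbB hcA
  exact ⟨m, ⟨hmA, hmB⟩, hC b hbC c hcC p hp m hm⟩

/-- The Helly property for finitely many convex sets of vertices of a tree. -/
theorem IsTree.exists_mem_of_pairwise_inter {V : Type u} {T : SimpleGraph V} (hT : T.IsTree)
    {ι : Type*} (s : Finset ι) (f : ι → Set V) (hf : ∀ i ∈ s, T.PathConvex (f i))
    (hff : ∀ i ∈ s, ∀ j ∈ s, (f i ∩ f j).Nonempty) : ∀ A : Set V, A.Nonempty → T.PathConvex A →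
    (∀ i ∈ s, (A ∩ f i).Nonempty) → ∃ t ∈ A, ∀ i ∈ s, t ∈ f i := by
  classical
  induction s using Finset.induction_on with
  | empty => exact fun A hA _ _ => ⟨hA.some, hA.some_mem, by simp⟩
  | insert j s hj ih =>
    intro A _ hAc hAf
    have hjs := Finset.mem_insert_self j s
    have hs : ∀ i ∈ s, i ∈ insert j s := fun i => Finset.mem_insert_of_mem
    obtain ⟨t, ht, hts⟩ := ih (fun i hi => hf i (hs i hi))
      (fun i hi l hl => hff i (hs i hi) l (hs l hl)) (A ∩ f j) (hAf j hjs) (hAc.inter (hf j hjs))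
      fun i hi => hT.inter_inter_nonempty hAc (hf j hjs) (hf i (hs i hi)) (hAf j hjs)
        (hAf i (hs i hi)) (hff j hjs i (hs i hi))
    refine ⟨t, ht.1, fun i hi => ?_⟩
    rcases Finset.mem_insert.1 hi with rfl | hi
    exacts [ht.2, hts i hi]

/-! ### Brambles against tree-decompositions -/

/-- The nodes whose bags meet a connected set of vertices form a connected set. -/
theorem TreeDecomposition.connOn_setOf_bag_inter {V : Type u} {G : SimpleGraph V}
    (D : G.TreeDecomposition) {B : Set V} (hB : G.ConnOn B) :
    D.tree.ConnOn {t | (D.bag t ∩ B).Nonempty} := by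
  have hv : ∀ v, D.tree.ConnOn {t | v ∈ D.bag t} := fun v =>
    connOn_iff_induce_connected.2 (D.connected_of_vertex v)
  obtain ⟨b, hb⟩ := hB.1
  obtain ⟨t, ht⟩ := D.exists_mem_bag b
  refine ⟨⟨t, b, ht, hb⟩, ?_⟩
  rintro Q ⟨s, ⟨v, hvs, hvB⟩, hsQ⟩ ⟨t, ⟨w, hwt, hwB⟩, htQ⟩
  have key : ∀ v ∈ B, ∀ s t, v ∈ D.bag s → s ∈ Q → v ∈ D.bag t → t ∉ Q →
      ∃ a ∈ {t | (D.bag t ∩ B).Nonempty}, a ∈ Q ∧ ∃ b ∈ {t | (D.bag t ∩ B).Nonempty}, b ∉ Q ∧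
        D.tree.Adj a b := by
    intro v hvB s t hs hsQ ht htQ
    obtain ⟨a, ha, haQ, b, hb, hbQ, hab⟩ := (hv v).2 Q ⟨s, hs, hsQ⟩ ⟨t, ht, htQ⟩
    exact ⟨a, ⟨v, ha, hvB⟩, haQ, b, ⟨v, hb, hvB⟩, hbQ, hab⟩
  by_cases hw : ∃ r ∈ Q, w ∈ D.bag r
  · obtain ⟨r, hrQ, hr⟩ := hw
    exact key w hwB r t hr hrQ hwt htQ
  -- `B` is cut according to which vertices occur in bags at `Q`. A bag containing the crossing edge
  -- lies outside `Q`, so the nodes of `a` meet both sides.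
  · obtain ⟨a, haB, ⟨r, hrQ, har⟩, b, hbB, hbP, hab⟩ := hB.2 {v | ∃ r ∈ Q, v ∈ D.bag r}
      ⟨v, hvB, s, hsQ, hvs⟩ ⟨w, hwB, hw⟩
    obtain ⟨q, haq, hbq⟩ := D.exists_adj_mem_bag a b hab
    exact key a haB r q har hrQ haq fun hqQ => hbP ⟨q, hqQ, hbq⟩

/-- A finite subset of a bramble is covered by a bag of any given tree-decomposition. -/
theorem TreeDecomposition.exists_covers_bag {V : Type u} {G : SimpleGraph V}
    (D : G.TreeDecomposition) {𝓑 : Set (Set V)} (h𝓑 : G.IsBramble 𝓑) {𝓕 : Set (Set V)}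
    (h𝓕 : 𝓕 ⊆ 𝓑) (hfin : 𝓕.Finite) : ∃ t, Covers (D.bag t) 𝓕 := by
  have hc : ∀ B ∈ 𝓑, D.tree.ConnOn {t | (D.bag t ∩ B).Nonempty} := fun B hB =>
    D.connOn_setOf_bag_inter (connOn_iff_induce_connected.2 (h𝓑.connected B hB))
  have hT := D.isTree
  obtain ⟨t, -, ht⟩ := hT.exists_mem_of_pairwise_inter hfin.toFinset
    (fun B => {t | (D.bag t ∩ B).Nonempty})
    (fun B hB => (hc B (h𝓕 (by simpa using hB))).pathConvex hT.isAcyclic)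
    (by
      intro A hA B hB
      rcases h𝓑.touch A (h𝓕 (by simpa using hA)) B (h𝓕 (by simpa using hB)) with
        ⟨x, hxA, hxB⟩ | ⟨a, ha, b, hb, hab⟩
      · obtain ⟨t, ht⟩ := D.exists_mem_bag x
        exact ⟨t, ⟨x, ht, hxA⟩, ⟨x, ht, hxB⟩⟩
      · obtain ⟨t, hta, htb⟩ := D.exists_adj_mem_bag a b hab
        exact ⟨t, ⟨a, hta, ha⟩, ⟨b, htb, hb⟩⟩)
    Set.univ (have := hT.connected.nonempty; Set.univ_nonempty) (fun _ _ _ _ _ _ _ _ => trivial)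
    (fun B hB => by
      rw [Set.univ_inter]
      exact (hc B (h𝓕 (by simpa using hB))).1)
  exact ⟨t, fun A hA => ht A (by simpa using hA)⟩

theorem TreewidthLT.brambleOrder_le {V : Type u} {G : SimpleGraph V} {k : ℕ} (h : G.TreewidthLT k)
    {𝓑 : Set (Set V)} (h𝓑 : G.IsFiniteBramble 𝓑) : brambleOrder 𝓑 ≤ k := by
  obtain ⟨D, hD⟩ := h
  refine brambleOrder_le_iff.2 (exists_cover_of_finite_subfamilies k 𝓑 h𝓑.finite ?_)
  intro 𝓕 h𝓕 hfin
  obtain ⟨t, ht⟩ := D.exists_covers_bag h𝓑.toIsBramble h𝓕 hfin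
  exact ⟨D.bag t, ht, hD t⟩

end SimpleGraph

theorem theorem6p2 {V : Type u} (G : SimpleGraph V) (k : ℕ) :
    G.TreewidthLT k ↔
      ¬ ∃ 𝓑 : Set (Set V), G.IsFiniteBramble 𝓑 ∧ (k : ℕ∞) < SimpleGraph.brambleOrder 𝓑 := by
  constructor
  · rintro h ⟨𝓑, h𝓑, hk⟩
    exact (h.brambleOrder_le h𝓑).not_gt hk
  · intro h
    push Not at h
    obtain ⟨H, hGH, hH, hK⟩ := SimpleGraph.exists_elim_of_finset
      (SimpleGraph.exists_elim_on_finset h)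
    exact hH.treewidthLT hGH hK
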